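/- Let $R:\mathbb R\times\mathbb R^m\to\mathbb R^m$ be smooth, and suppose the ODE system $q'(t)=R(t,q(t))$ has $\ell$ smooth invariants $G_1,\dots,G_\ell:\mathbb R^m\to\mathbb R$, i.e. $\nabla G_j(q)^T R(t,q)=0$ for all $t\in[0,T]$, $q\in\mathbb R^m$ and $j=1,\dots,\ell$. Consider an explicit $s$-stage Runge–Kutta method of order $p\ge 2$. For a state $(t_n,q^n)$ with $t_n\in[0,T)$ and a step size $\Delta t>0$ let $$q^{n+1}=q^n+\Delta t\sum_{j=1}^s b_jR_j,\qquad R_i=R\Big(t_n+c_i\Delta t,\;q^n+\Delta t\sum_{j<i}a_{ij}R_j\Big),\qquad c_i=\sum_{j}a_{ij},$$ let $\mathcal S=\operatorname{span}(R_1,\dots,R_s)$, and let $\nabla G_{j,s}$ denote the orthogonal projection of $\nabla G_j(q^{n+1})$ onto $\mathcal S$. (A one-step scheme has order at least $p$ at $(t_n,q^n)$ if its result after one step of size $\Delta t$ from $(t_n,q^n)$ differs from $q(t_n+\Delta t)$ by $O(\Delta t^{p+1})$ as $\Delta t\to0^+$, where $q$ is the exact solution with $q(t_n)=q^n$. A Runge–Kutta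 method has order $p$ if this holds for every smooth ODE system and every state.) Suppose that, for all sufficiently small $\Delta t>0$, there are unit vectors $\Phi^{(1)},\dots,\Phi^{(\ell)}\in\mathcal S$, depending on $\Delta t$ (for example the search directions of a directional projection method, which are normalized linear combinations of the $R_j$), such that the limit $$M(\Phi^{(1)},\dots,\Phi^{(\ell)})=\lim_{\Delta t\to0^+}\Big[\nabla G_i(q^{n+1})^T\Phi^{(j)}\Big]_{i,j=1}^{\ell}$$ exists and is a nonsingular matrix. Then there are $h^*>0$ and $\rho>0$ such that: 1. for every $\Delta t\in(0,h^*]$ the vectors $\nabla G_{1,s},\dots,\nabla G_{\ell,s}$ are all nonzero, and the quasi-orthogonal projection equations $$\hat q^{\,n+1}=q^{n+1}+\sum_{j=1}^{\ell}\lambda_n^{(j)}\frac{\nabla G_{j,s}}{\|\nabla G_{j,s}\|_2},\qquad G_i(\hat q^{\,n+1})=G_i(q^n)\quad(i=1,\dots,\ell)$$ have a solution $\lambda_n\in\mathbb R^\ell$ with $\max_j|\lambda_n^{(j)}|\le\rho$; 2. for every choice, for each $\Delta t\in(0,h^*]$, of a solution $\lambda_n=\lambda_n(\Delta t)$ with $\max_j|\lambda_n^{(j)}|\le\rho$,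 the projected scheme $\hat q^{\,n+1}$ has order at least $p$ at $(t_n,q^n)$. -/

import Mathlib

open Filter Topology Asymptotics
open scoped ContDiff

noncomputable section

namespace QuasiOrth

/-- The state space `ℝ^m` with its Euclidean inner product and norm. -/
abbrev State (m : ℕ) := EuclideanSpace ℝ (Fin m)

/-- `u` solves `u' = R(τ, u)` on `[t, t + δ]` with `u(t) = q`
(one-sided derivatives at the end points). -/
def IsSolution {m : ℕ} (R : ℝ → State m → State m) (t : ℝ) (q : State m) (δ : ℝ)
    (u : ℝ → State m) : Prop :=
  u t = q ∧
    ∀ τ ∈ Set.Icc t (t + δ), HasDerivWithinAt u (R τ (u τ)) (Set.Icc t (t + δ)) τ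

/-- `G` is a smooth invariant of `q' = R(t, q)` for times in `[0, T]`:
`∇G(q)ᵀ R(t, q) = 0`. -/
def IsInvariant {m : ℕ} (R : ℝ → State m → State m) (T : ℝ) (G : State m → ℝ) : Prop :=
  ContDiff ℝ ∞ G ∧
    ∀ t ∈ Set.Icc (0 : ℝ) T, ∀ q : State m, inner ℝ (gradient G q) (R t q) = 0

/-- Order of accuracy at least `p` at the state `(t, q)`: the result `step h` of one step of size
`h` from `(t, q)` differs from the exact solution through `(t, q)` by `O(h^(p+1))`, `h → 0+`. -/
def OrderAt {m : ℕ} (R : ℝ → State m → State m) (t : ℝ) (q : State m)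
    (step : ℝ → State m) (p : ℕ) : Prop :=
  ∀ (δ : ℝ) (u : ℝ → State m), 0 < δ → IsSolution R t q δ u →
    (fun h : ℝ => step h - u (t + h)) =O[𝓝[>] 0] (fun h : ℝ => h ^ (p + 1))

/-- The coefficients of an explicit Runge–Kutta method with `s` stages. -/
structure ExplicitRK (s : ℕ) where
  /-- the coefficients `a_{ij}` -/
  a : Fin s → Fin s → ℝ
  /-- the weights `b_j` -/
  b : Fin s → ℝ
  explicit : ∀ i j, i ≤ j → a i j = 0

namespace ExplicitRK

/-- The abscissae `c_i = ∑_j a_{ij}`. -/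
def c {s : ℕ} (rk : ExplicitRK s) (i : Fin s) : ℝ := ∑ j, rk.a i j

/-- The stage derivatives `R_i` of a step of size `h` from `(t, q)`. -/
def stage {s m : ℕ} (rk : ExplicitRK s) (R : ℝ → State m → State m) (t : ℝ) (q : State m)
    (h : ℝ) (i : Fin s) : State m :=
  R (t + rk.c i * h)
    (q + h • ∑ j : Fin s, if _hj : j < i then rk.a i j • stage rk R t q h j else 0)
termination_by i.val
decreasing_by exact _hj

/-- The stage derivatives satisfy the usual stage equations. -/
theorem stage_eq {s m : ℕ} (rk : ExplicitRK s) (R : ℝ → State m → State m) (t : ℝ) (q : State m)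
    (h : ℝ) (i : Fin s) :
    rk.stage R t q h i =
      R (t + rk.c i * h) (q + h • ∑ j : Fin s, rk.a i j • rk.stage R t q h j) := by
  rw [stage]
  congr 3
  refine Finset.sum_congr rfl fun j _ => ?_
  by_cases hj : j < i
  · simp [hj]
  · simp [hj, rk.explicit i j (not_lt.mp hj)]

/-- The Runge–Kutta update `q^{n+1} = q + h ∑_j b_j R_j`. -/
def step {s m : ℕ} (rk : ExplicitRK s) (R : ℝ → State m → State m) (t : ℝ) (q : State m)
    (h : ℝ) : State m :=
  q + h • ∑ j : Fin s, rk.b j • rk.stage R t q h j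

/-- The method has order (at least) `p`: its local error is `O(h^(p+1))` for every smooth ODE
system and every initial state. -/
def HasOrder {s : ℕ} (rk : ExplicitRK s) (p : ℕ) : Prop :=
  ∀ (m : ℕ) (R : ℝ → State m → State m),
    ContDiff ℝ ∞ (fun x : ℝ × State m => R x.1 x.2) →
    ∀ (t : ℝ) (q : State m), OrderAt R t q (rk.step R t q) p

/-- The span `𝒮` of the stage derivatives. -/
def stageSpan {s m : ℕ} (rk : ExplicitRK s) (R : ℝ → State m → State m) (t : ℝ) (q : State m)
    (h : ℝ) : Submodule ℝ (State m) :=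
  Submodule.span ℝ (Set.range (rk.stage R t q h))

/-- `∇G_s`: the orthogonal projection of `∇G(q^{n+1})` onto `𝒮`. -/
def gradS {s m : ℕ} (rk : ExplicitRK s) (R : ℝ → State m → State m) (G : State m → ℝ)
    (t : ℝ) (q : State m) (h : ℝ) : State m :=
  (rk.stageSpan R t q h).starProjection (gradient G (rk.step R t q h))

/-- The matrix `[∇G_i(q^{n+1})ᵀ d_j]`. -/
def dirMatrix {s m l : ℕ} (rk : ExplicitRK s) (R : ℝ → State m → State m)
    (G : Fin l → State m → ℝ) (t : ℝ) (q : State m) (h : ℝ) (d : Fin l → State m) :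
    Matrix (Fin l) (Fin l) ℝ :=
  Matrix.of fun i j => inner ℝ (gradient (G i) (rk.step R t q h)) (d j)

/-- The point `q^{n+1} + ∑_j λ_j ∇G_{j,s} / ‖∇G_{j,s}‖`. -/
def qoPoint {s m l : ℕ} (rk : ExplicitRK s) (R : ℝ → State m → State m)
    (G : Fin l → State m → ℝ) (t : ℝ) (q : State m) (h : ℝ) (lam : Fin l → ℝ) : State m :=
  rk.step R t q h +
    ∑ j : Fin l, lam j • (‖rk.gradS R (G j) t q h‖⁻¹ • rk.gradS R (G j) t q h)

/-- `λ` solves the projection equations `G_i(q̂^{n+1}) = G_i(q^n)`, `i = 1, …, l`. -/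
def SolvesQO {s m l : ℕ} (rk : ExplicitRK s) (R : ℝ → State m → State m)
    (G : Fin l → State m → ℝ) (t : ℝ) (q : State m) (h : ℝ) (lam : Fin l → ℝ) : Prop :=
  ∀ i : Fin l, G i (rk.qoPoint R G t q h lam) = G i q

end ExplicitRK

end QuasiOrth

end

/-! Write `n_j` for the gradients at the Runge–Kutta point, `P` for the projection onto the stage
span, and `F_h(λ)` for the invariants at the projected point. The span and the normalized directions
need not converge as `h → 0+`, so an implicit function theorem at `h = 0` is unavailable; every
estimate is instead made uniform in `h`. The Jacobian of `F_h` at `λ = 0` is the Gram matrix of the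
`P n_j` with normalized columns. Nonsingularity of the limit `M` bounds the inverses of the matrices
`[n_i · Φ_j]`, which makes the `P n_j` uniformly independent, hence the Jacobian uniformly bounded
below (`eventually_qoJac_bound`). On a ball of fixed radius `ρ`, `F_h` is uniformly close to this
linear map (`eventually_approximatesLinearOn_qoJac`). A quantitative inverse function theorem then
gives a solution, and bounds every solution in the ball by a constant times the residual `G(q^n) -
G(q^{n+1})`. As `G` is constant along the exact flow, that residual is `O(h^(p+1))`, so the
correction preserves the order. -/

/-! ### Linear algebra: lower bounds for projected gradients -/

/-- Testing `∑ μ_j P n_j` against `d_k ∈ S` removes the projection and returns the entries of `μD`;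
inverting `D` recovers `μ`. -/
theorem norm_le_of_inner_matrix {E : Type*} [NormedAddCommGroup E] [InnerProductSpace ℝ E]
    (S : Submodule ℝ E) [S.HasOrthogonalProjection] {l : ℕ} (n d : Fin l → E) {B : ℝ}
    (hd : ∀ j, d j ∈ S) (hd1 : ∀ j, ‖d j‖ ≤ 1)
    (hdet : (Matrix.of fun i j => inner ℝ (n i) (d j)).det ≠ 0)
    (hB : ∀ i j, |(Matrix.of fun i j => inner ℝ (n i) (d j))⁻¹ i j| ≤ B) (hB0 : 0 ≤ B)
    (μ : Fin l → ℝ) :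
    ‖μ‖ ≤ l * B * ‖∑ j, μ j • S.starProjection (n j)‖ := by
  set D : Matrix (Fin l) (Fin l) ℝ := Matrix.of fun i j => inner ℝ (n i) (d j) with hD
  set w := ∑ j, μ j • S.starProjection (n j) with hw
  have h1 : ∀ k, Matrix.vecMul μ D k = inner ℝ w (d k) := by
    intro k
    simp only [Matrix.vecMul, dotProduct, hw, sum_inner, inner_smul_left, hD, Matrix.of_apply]
    refine Finset.sum_congr rfl fun j _ => ?_
    rw [S.inner_starProjection_left_eq_right, Submodule.starProjection_eq_self_iff.mpr (hd k)]
    simp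
  have h2 : ∀ k, |Matrix.vecMul μ D k| ≤ ‖w‖ := by
    intro k
    rw [h1]
    calc |inner ℝ w (d k)| ≤ ‖w‖ * ‖d k‖ := abs_real_inner_le_norm _ _
      _ ≤ ‖w‖ * 1 := by gcongr; exact hd1 k
      _ = ‖w‖ := mul_one _
  have h3 : Matrix.vecMul (Matrix.vecMul μ D) D⁻¹ = μ := by
    rw [Matrix.vecMul_vecMul, Matrix.mul_nonsing_inv _ (isUnit_iff_ne_zero.mpr hdet),
      Matrix.vecMul_one]
  refine (pi_norm_le_iff_of_nonneg (by positivity)).mpr fun i => ?_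
  rw [← h3]
  calc ‖Matrix.vecMul (Matrix.vecMul μ D) D⁻¹ i‖
      = ‖∑ k, Matrix.vecMul μ D k * D⁻¹ k i‖ := rfl
    _ ≤ ∑ k, ‖Matrix.vecMul μ D k * D⁻¹ k i‖ := norm_sum_le _ _
    _ ≤ ∑ _k : Fin l, ‖w‖ * B := by
        gcongr with k
        rw [norm_mul]
        exact mul_le_mul (h2 k) (hB k i) (norm_nonneg _) (norm_nonneg _)
    _ = l * B * ‖w‖ := by simp; ring

/-- An energy argument: for `w = ∑ μ_j P n_j`, which lies in `S`, one has `‖w‖² = ∑ μ_j ⟨n_j, w⟩`.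
This is linear in `μ`, while `hK` makes it at least quadratic. Undoing the normalization costs only
the upper bound `C` on the gradients. -/
theorem norm_le_of_normalized_directions {E : Type*} [NormedAddCommGroup E]
    [InnerProductSpace ℝ E] (S : Submodule ℝ E) [S.HasOrthogonalProjection] {l : ℕ}
    (n : Fin l → E) {K C : ℝ}
    (hK : ∀ μ : Fin l → ℝ, ‖μ‖ ≤ K * ‖∑ j, μ j • S.starProjection (n j)‖)
    (hC : ∀ j, ‖n j‖ ≤ C) (hC0 : 0 ≤ C) (hne : ∀ j, S.starProjection (n j) ≠ 0)
    (lam : Fin l → ℝ) :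
    ‖lam‖ ≤ C * (K ^ 2 * l) * ‖fun i => inner ℝ (n i)
      (∑ j, lam j • (‖S.starProjection (n j)‖⁻¹ • S.starProjection (n j)))‖ := by
  set μ : Fin l → ℝ := fun j => lam j * ‖S.starProjection (n j)‖⁻¹ with hμ
  set w := ∑ j, lam j • (‖S.starProjection (n j)‖⁻¹ • S.starProjection (n j)) with hw
  set y : Fin l → ℝ := fun i => inner ℝ (n i) w with hy
  have hwμ : w = ∑ j, μ j • S.starProjection (n j) := by simp [hw, hμ, smul_smul]
  have hwS : w ∈ S := hwμ ▸
    S.sum_mem fun j _ => S.smul_mem _ (S.starProjection_apply_mem (n j))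
  have h1 : ‖w‖ ^ 2 ≤ l * ‖μ‖ * ‖y‖ := by
    have : ‖w‖ ^ 2 = ∑ j, μ j * y j := by
      rw [← real_inner_self_eq_norm_sq]
      nth_rw 1 [hwμ]
      rw [sum_inner]
      refine Finset.sum_congr rfl fun j _ => ?_
      rw [inner_smul_left, S.inner_starProjection_left_eq_right,
        Submodule.starProjection_eq_self_iff.mpr hwS]
      simp [hy]
    rw [this]
    calc ∑ j, μ j * y j ≤ ∑ _j : Fin l, ‖μ‖ * ‖y‖ := by
          refine Finset.sum_le_sum fun j _ => (le_abs_self _).trans ?_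
          rw [abs_mul]
          exact mul_le_mul (norm_le_pi_norm μ j) (norm_le_pi_norm y j) (abs_nonneg _)
            (norm_nonneg _)
      _ = l * ‖μ‖ * ‖y‖ := by simp; ring
  have h2 : ‖μ‖ ^ 2 ≤ K ^ 2 * ‖w‖ ^ 2 := by
    rw [← mul_pow]
    exact pow_le_pow_left₀ (norm_nonneg _) (hwμ ▸ hK μ) 2
  have h3 : ‖μ‖ ≤ K ^ 2 * l * ‖y‖ := by
    rcases (norm_nonneg μ).eq_or_lt with h | h
    · rw [← h]; positivity
    -- One factor `‖μ‖` cancels from the quadratic inequality.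
    · refine le_of_mul_le_mul_left ?_ h
      calc ‖μ‖ * ‖μ‖ = ‖μ‖ ^ 2 := by ring
        _ ≤ K ^ 2 * ‖w‖ ^ 2 := h2
        _ ≤ K ^ 2 * (l * ‖μ‖ * ‖y‖) := by gcongr
        _ = ‖μ‖ * (K ^ 2 * l * ‖y‖) := by ring
  refine (pi_norm_le_iff_of_nonneg (by positivity)).mpr fun i => ?_
  have h4 : lam i = ‖S.starProjection (n i)‖ * μ i := by
    have := norm_ne_zero_iff.mpr (hne i)
    simp only [hμ]; field_simp
  calc ‖lam i‖ = ‖S.starProjection (n i)‖ * ‖μ i‖ := by rw [h4, norm_mul, norm_norm]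
    _ ≤ C * ‖μ‖ := mul_le_mul ((S.norm_starProjection_apply_le _).trans (hC i))
        (norm_le_pi_norm μ i) (norm_nonneg _) hC0
    _ ≤ C * (K ^ 2 * l * ‖y‖) := by gcongr
    _ = C * (K ^ 2 * l) * ‖y‖ := by ring

/-! ### Quantitative inverse function theorem -/

/-- Since `K * c ≤ 1 / 2`, the nonlinear error is at most `‖x‖ / 2` and is absorbed on the left;
this controls every solution in the ball. -/
theorem ApproximatesLinearOn.norm_le_of_antilipschitz {E F : Type*} [NormedAddCommGroup E]
    [NormedSpace ℝ E] [NormedAddCommGroup F] [NormedSpace ℝ F] {f : E → F} {A : E →L[ℝ] F}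
    {s : Set E} {c : NNReal} (hf : ApproximatesLinearOn f A s c) {K : ℝ} (hK0 : 0 < K)
    (hK : ∀ x, ‖x‖ ≤ K * ‖A x‖) (hc : K * c ≤ 1 / 2) (h0 : 0 ∈ s) {x : E} (hx : x ∈ s) :
    ‖x‖ ≤ 2 * K * ‖f x - f 0‖ := by
  have h1 := hf x hx 0 h0
  rw [sub_zero] at h1
  have h2 : ‖A x‖ ≤ ‖f x - f 0‖ + ‖f x - f 0 - A x‖ := by
    simpa using norm_sub_le (f x - f 0) (f x - f 0 - A x)
  have h3 : ‖x‖ ≤ K * ‖f x - f 0‖ + K * c * ‖x‖ := by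
    calc ‖x‖ ≤ K * ‖A x‖ := hK x
      _ ≤ K * (‖f x - f 0‖ + c * ‖x‖) := by gcongr; linarith
      _ = _ := by ring
  nlinarith [norm_nonneg x]

theorem ApproximatesLinearOn.exists_eq_of_antilipschitz {E : Type*} [NormedAddCommGroup E]
    [NormedSpace ℝ E] [FiniteDimensional ℝ E] {f : E → E} {A : E →L[ℝ] E}
    {ρ : ℝ} {c : NNReal} (hf : ApproximatesLinearOn f A (Metric.closedBall 0 ρ) c)
    {K : ℝ} (hK0 : 0 < K) (hK : ∀ x, ‖x‖ ≤ K * ‖A x‖) (hc : K * c ≤ 1 / 2) (hρ : 0 ≤ ρ)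
    {y : E} (hy : ‖y - f 0‖ ≤ ρ / (2 * K)) :
    ∃ x, ‖x‖ ≤ ρ ∧ f x = y := by
  have : CompleteSpace E := FiniteDimensional.complete ℝ E
  have hinj : Function.Injective (A : E →ₗ[ℝ] E) := by
    rw [injective_iff_map_eq_zero]
    intro x hx
    have := hK x
    rw [show A x = 0 from hx, norm_zero, mul_zero] at this
    exact norm_le_zero_iff.mp this
  let e := LinearEquiv.ofInjectiveEndo (A : E →ₗ[ℝ] E) hinj
  have he : ∀ y, A (e.symm y) = y := fun y => e.apply_symm_apply y
  let g : A.NonlinearRightInverse :=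
    ⟨fun y => e.symm y, K.toNNReal, fun y => by
      simpa [he, Real.coe_toNNReal _ hK0.le] using hK (e.symm y), he⟩
  have hsurj := hf.surjOn_closedBall_of_nonlinearRightInverse g hρ subset_rfl
  -- The image covers radius `(K⁻¹ - c) * ρ`, which is at least `ρ / (2 * K)` because `c ≤ 1 / (2 *
  -- K)`.
  have hmem : y ∈ Metric.closedBall (f 0) (((g.nnnorm : ℝ)⁻¹ - c) * ρ) := by
    rw [mem_closedBall_iff_norm]
    refine hy.trans ?_
    have hg : (g.nnnorm : ℝ) = K := Real.coe_toNNReal _ hK0.le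
    rw [hg]
    have h1 : (c : ℝ) ≤ 1 / (2 * K) := by
      rw [le_div_iff₀ (by positivity)]; linarith
    have h2 : K⁻¹ = 1 / (2 * K) + 1 / (2 * K) := by field_simp; norm_num
    calc ρ / (2 * K) = 1 / (2 * K) * ρ := by ring
      _ ≤ (K⁻¹ - c) * ρ := by gcongr; linarith
  obtain ⟨x, hx, hxy⟩ := hsurj hmem
  exact ⟨x, mem_closedBall_zero_iff.mp hx, hxy⟩

/-- The gradient is taken at a free point `z`, not at `q`, because the Jacobian is later evaluated
at the moving point `q^{n+1}`. -/
theorem exists_ball_approximates_gradient {E : Type*} [NormedAddCommGroup E]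
    [InnerProductSpace ℝ E] [CompleteSpace E] {G : E → ℝ} (hG : ContDiff ℝ ∞ G) (q : E)
    {ε : ℝ} (hε : 0 < ε) :
    ∃ r > 0, ∀ z ∈ Metric.ball q r, ∀ x ∈ Metric.ball q r, ∀ y ∈ Metric.ball q r,
      |G x - G y - inner ℝ (gradient G z) (x - y)| ≤ ε * ‖x - y‖ := by
  have h1 : HasStrictFDerivAt G (fderiv ℝ G q) q := hG.contDiffAt.hasStrictFDerivAt (by simp)
  have h2 := h1.isLittleO.def (half_pos hε)
  have h3 : ∀ᶠ z in 𝓝 q, ‖fderiv ℝ G z - fderiv ℝ G q‖ < ε / 2 := by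
    have : ContinuousAt (fderiv ℝ G) q := (hG.continuous_fderiv (by simp)).continuousAt
    simpa [dist_eq_norm] using Metric.continuousAt_iff'.mp this _ (half_pos hε)
  rw [nhds_prod_eq, eventually_prod_self_iff'] at h2
  obtain ⟨s, hs, hs2⟩ := h2
  obtain ⟨r, hr, hr2⟩ := Metric.mem_nhds_iff.mp (Filter.inter_mem hs h3)
  refine ⟨r, hr, fun z hz x hx y hy => ?_⟩
  have e1 : ‖G x - G y - fderiv ℝ G q (x - y)‖ ≤ ε / 2 * ‖x - y‖ :=
    hs2 x (hr2 hx).1 y (hr2 hy).1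
  have e2 : ‖(fderiv ℝ G z - fderiv ℝ G q) (x - y)‖ ≤ ε / 2 * ‖x - y‖ :=
    ((fderiv ℝ G z - fderiv ℝ G q).le_opNorm _).trans
      (mul_le_mul_of_nonneg_right (hr2 hz).2.le (norm_nonneg _))
  rw [gradient, InnerProductSpace.toDual_symm_apply]
  have : G x - G y - fderiv ℝ G z (x - y) = (G x - G y - fderiv ℝ G q (x - y)) -
      (fderiv ℝ G z - fderiv ℝ G q) (x - y) := by
    rw [sub_apply]; ring
  rw [this, ← Real.norm_eq_abs]
  linarith [norm_sub_le (G x - G y - fderiv ℝ G q (x - y))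
    ((fderiv ℝ G z - fderiv ℝ G q) (x - y))]

/-! ### Small-step limits and conservation along exact solutions -/

namespace QuasiOrth

theorem ExplicitRK.continuous_stage {s m : ℕ} (rk : ExplicitRK s) {R : ℝ → State m → State m}
    (hR : Continuous (fun x : ℝ × State m => R x.1 x.2)) (t : ℝ) (q : State m) (i : Fin s) :
    Continuous fun h => rk.stage R t q h i := by
  induction i using WellFoundedLT.induction with
  | ind i ih =>
    have : (fun h => rk.stage R t q h i) = fun h => (fun x : ℝ × State m => R x.1 x.2)
        (t + rk.c i * h, q + h • ∑ j, rk.a i j • rk.stage R t q h j) :=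
      funext fun h => rk.stage_eq R t q h i
    have hj : ∀ j, Continuous fun h => rk.a i j • rk.stage R t q h j := fun j => by
      by_cases hj : j < i
      · exact (ih j hj).const_smul (rk.a i j)
      · simp only [rk.explicit i j (not_lt.mp hj), zero_smul]; exact continuous_const
    rw [this]
    exact hR.comp (Continuous.prodMk (by fun_prop) (by fun_prop))

theorem ExplicitRK.tendsto_step {s m : ℕ} (rk : ExplicitRK s) {R : ℝ → State m → State m}
    (hR : Continuous (fun x : ℝ × State m => R x.1 x.2)) (t : ℝ) (q : State m) :
    Tendsto (rk.step R t q) (𝓝[>] 0) (𝓝 q) := by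
  have hs := rk.continuous_stage hR t q
  have hc : Continuous (rk.step R t q) := by unfold ExplicitRK.step; fun_prop
  have h := hc.tendsto 0
  simp only [ExplicitRK.step, zero_smul, add_zero] at h
  exact h.mono_left nhdsWithin_le_nhds

theorem IsInvariant.eq_of_isSolution {m : ℕ} {R : ℝ → State m → State m} {T : ℝ}
    {G : State m → ℝ} (hG : IsInvariant R T G) {t : ℝ} (ht : 0 ≤ t) {q : State m} {δ : ℝ}
    {u : ℝ → State m} (hu : IsSolution R t q δ u) {h : ℝ} (h0 : 0 < h) (hδ : h ≤ δ)
    (hT : t + h ≤ T) : G (u (t + h)) = G q := by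
  have hsub : Set.Icc t (t + h) ⊆ Set.Icc t (t + δ) := Set.Icc_subset_Icc_right (by linarith)
  have hd : ∀ τ ∈ Set.Icc t (t + h), HasDerivWithinAt (G ∘ u) 0 (Set.Icc t (t + h)) τ := by
    intro τ hτ
    have hGd : HasFDerivAt G (fderiv ℝ G (u τ)) (u τ) :=
      (hG.1.differentiable (by simp) (u τ)).hasFDerivAt
    have h1 := hGd.comp_hasDerivWithinAt τ ((hu.2 τ (hsub hτ)).mono hsub)
    have h2 := hG.2 τ ⟨ht.trans hτ.1, hτ.2.trans hT⟩ (u τ)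
    rw [gradient, InnerProductSpace.toDual_symm_apply] at h2
    rwa [h2] at h1
  have h3 := constant_of_derivWithin_zero (f := G ∘ u) (a := t) (b := t + h)
    (fun τ hτ => (hd τ hτ).differentiableWithinAt)
    (fun τ hτ => (hd τ ⟨hτ.1, hτ.2.le⟩).derivWithin
      (uniqueDiffOn_Icc (by linarith) τ ⟨hτ.1, hτ.2.le⟩))
    (t + h) ⟨by linarith, le_rfl⟩
  simpa [hu.1] using h3

theorem IsSolution.tendsto {m : ℕ} {R : ℝ → State m → State m} {t : ℝ} {q : State m} {δ : ℝ}
    (hδ : 0 < δ) {u : ℝ → State m} (hu : IsSolution R t q δ u) :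
    Tendsto (fun h => u (t + h)) (𝓝[>] 0) (𝓝 q) := by
  have h1 : Tendsto u (𝓝[Set.Icc t (t + δ)] t) (𝓝 q) := by
    have := (hu.2 t ⟨le_rfl, by linarith⟩).continuousWithinAt
    rwa [ContinuousWithinAt, hu.1] at this
  refine h1.comp (tendsto_nhdsWithin_iff.mpr ⟨?_, ?_⟩)
  · have : Tendsto (fun h : ℝ => t + h) (𝓝 0) (𝓝 (t + 0)) := tendsto_id.const_add t
    rw [add_zero] at this
    exact this.mono_left nhdsWithin_le_nhds
  · filter_upwards [Ioc_mem_nhdsGT hδ] with h hh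
    exact ⟨by linarith [hh.1], by linarith [hh.2]⟩

/-! ### Uniform estimates for the projection equations -/

namespace ExplicitRK

variable {m s l : ℕ} (rk : ExplicitRK s) (R : ℝ → State m → State m)
  (G : Fin l → State m → ℝ) (t : ℝ) (q : State m)

/-- The displacement of the quasi-orthogonal projection, as a linear map of the multipliers. -/
noncomputable def qoDisp (h : ℝ) : (Fin l → ℝ) →L[ℝ] State m :=
  ∑ j, (ContinuousLinearMap.proj (R := ℝ) (φ := fun _ : Fin l => ℝ) j).smulRight
    (‖rk.gradS R (G j) t q h‖⁻¹ • rk.gradS R (G j) t q h)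

theorem qoDisp_apply (h : ℝ) (lam : Fin l → ℝ) :
    rk.qoDisp R G t q h lam =
      ∑ j, lam j • (‖rk.gradS R (G j) t q h‖⁻¹ • rk.gradS R (G j) t q h) := by
  simp [qoDisp]

theorem qoPoint_eq (h : ℝ) (lam : Fin l → ℝ) :
    rk.qoPoint R G t q h lam = rk.step R t q h + rk.qoDisp R G t q h lam := by
  rw [qoDisp_apply, qoPoint]

theorem norm_qoDisp_le (h : ℝ) (lam : Fin l → ℝ) :
    ‖rk.qoDisp R G t q h lam‖ ≤ l * ‖lam‖ := by
  rw [qoDisp_apply]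
  calc _ ≤ ∑ j, ‖lam j • (‖rk.gradS R (G j) t q h‖⁻¹ • rk.gradS R (G j) t q h)‖ :=
        norm_sum_le _ _
    _ ≤ ∑ _j : Fin l, ‖lam‖ * 1 := by
        gcongr with j
        rw [norm_smul, norm_smul, norm_inv, norm_norm]
        exact mul_le_mul (norm_le_pi_norm lam j) inv_mul_le_one (by positivity) (norm_nonneg _)
    _ = l * ‖lam‖ := by simp

/-- The Jacobian at `λ = 0` of the map `λ ↦ (G_i(q̂))_i`. -/
noncomputable def qoJac (h : ℝ) : (Fin l → ℝ) →L[ℝ] (Fin l → ℝ) :=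
  ContinuousLinearMap.pi fun i =>
    (innerSL ℝ (gradient (G i) (rk.step R t q h))).comp (rk.qoDisp R G t q h)

theorem qoJac_apply (h : ℝ) (lam : Fin l → ℝ) (i : Fin l) :
    rk.qoJac R G t q h lam i =
      inner ℝ (gradient (G i) (rk.step R t q h)) (rk.qoDisp R G t q h lam) := rfl

variable {R G t q}

theorem eventually_qoJac_bound (hR : Continuous (fun x : ℝ × State m => R x.1 x.2))
    (hG : ∀ j, ContDiff ℝ ∞ (G j)) (Φ : Fin l → ℝ → State m)
    (hΦ : ∀ᶠ h in 𝓝[>] (0 : ℝ), ∀ j, Φ j h ∈ rk.stageSpan R t q h ∧ ‖Φ j h‖ = 1)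
    (M : Matrix (Fin l) (Fin l) ℝ)
    (hM : Tendsto (fun h : ℝ => rk.dirMatrix R G t q h (fun j => Φ j h)) (𝓝[>] 0) (𝓝 M))
    (hdet : M.det ≠ 0) :
    ∃ K > 0, ∀ᶠ h in 𝓝[>] (0 : ℝ), (∀ j, rk.gradS R (G j) t q h ≠ 0) ∧
      ∀ lam, ‖lam‖ ≤ K * ‖rk.qoJac R G t q h lam‖ := by
  have hinv : Tendsto (fun h : ℝ => (rk.dirMatrix R G t q h (fun j => Φ j h))⁻¹) (𝓝[>] 0)
      (𝓝 M⁻¹) :=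
    (continuousAt_matrix_inv M (NormedRing.inverse_continuousAt (Units.mk0 _ hdet))).tendsto.comp hM
  have hdet' : ∀ᶠ h in 𝓝[>] (0 : ℝ), (rk.dirMatrix R G t q h (fun j => Φ j h)).det ≠ 0 :=
    ((continuous_id.matrix_det.tendsto M).comp hM).eventually_ne hdet
  -- Strict bounds at the limit persist for all small `h`; `C` below is chosen likewise.
  obtain ⟨B, hB0, hB⟩ : ∃ B : ℝ, 0 ≤ B ∧ ∀ i j, |M⁻¹ i j| < B := by
    refine ⟨∑ i, ∑ j, |M⁻¹ i j| + 1, by positivity, fun i j => ?_⟩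
    have h1 := Finset.single_le_sum (f := fun j => |M⁻¹ i j|) (fun _ _ => abs_nonneg _)
      (Finset.mem_univ j)
    have h2 := Finset.single_le_sum (f := fun i => ∑ j, |M⁻¹ i j|)
      (fun _ _ => Finset.sum_nonneg fun _ _ => abs_nonneg _) (Finset.mem_univ i)
    beta_reduce at h1 h2
    linarith
  have hBev : ∀ᶠ h in 𝓝[>] (0 : ℝ), ∀ i j,
      |(rk.dirMatrix R G t q h (fun j => Φ j h))⁻¹ i j| ≤ B := by
    refine eventually_all.mpr fun i => eventually_all.mpr fun j => ?_
    have : Tendsto (fun h : ℝ => |(rk.dirMatrix R G t q h (fun j => Φ j h))⁻¹ i j|) (𝓝[>] 0)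
        (𝓝 |M⁻¹ i j|) := ((tendsto_pi_nhds.mp (tendsto_pi_nhds.mp hinv i)) j).abs
    exact (this.eventually_lt_const (hB i j)).mono fun _ h => h.le
  obtain ⟨C, hC0, hC⟩ : ∃ C : ℝ, 0 ≤ C ∧ ∀ i, ‖gradient (G i) q‖ < C := by
    refine ⟨∑ i, ‖gradient (G i) q‖ + 1, by positivity, fun i => ?_⟩
    have h1 := Finset.single_le_sum (f := fun i => ‖gradient (G i) q‖) (fun _ _ => norm_nonneg _)
      (Finset.mem_univ i)
    beta_reduce at h1
    linarith
  have hCev : ∀ᶠ h in 𝓝[>] (0 : ℝ), ∀ i, ‖gradient (G i) (rk.step R t q h)‖ ≤ C := by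
    refine eventually_all.mpr fun i => ?_
    have hc : Continuous (gradient (G i)) :=
      (InnerProductSpace.toDual ℝ (State m)).symm.continuous.comp
        ((hG i).continuous_fderiv (by simp))
    have := ((hc.tendsto q).comp (rk.tendsto_step hR t q)).norm
    exact (this.eventually_lt_const (hC i)).mono fun _ h => h.le
  refine ⟨C * ((l * B) ^ 2 * l) + 1, by positivity, ?_⟩
  filter_upwards [hΦ, hdet', hBev, hCev] with h h1 h2 h3 h4
  have key := norm_le_of_inner_matrix (rk.stageSpan R t q h)
    (fun i => gradient (G i) (rk.step R t q h)) (fun j => Φ j h) (fun j => (h1 j).1)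
    (fun j => (h1 j).2.le) h2 h3 hB0
  have hne : ∀ j, rk.gradS R (G j) t q h ≠ 0 := by
    intro j hj
    -- A vanishing projected gradient would contradict the lower bound at the unit multiplier `e_j`.
    have := key (Pi.single j 1)
    simp only [Pi.single_apply, ite_smul, one_smul, zero_smul, Finset.sum_ite_eq',
      Finset.mem_univ, if_true] at this
    rw [show (rk.stageSpan R t q h).starProjection (gradient (G j) (rk.step R t q h)) = 0 from hj,
      norm_zero, mul_zero] at this
    have h5 := congrFun (norm_le_zero_iff.mp this) j
    simp at h5
  refine ⟨hne, fun lam => ?_⟩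
  have h6 := norm_le_of_normalized_directions (rk.stageSpan R t q h)
    (fun i => gradient (G i) (rk.step R t q h)) key h4 hC0 hne lam
  have h7 : (fun i => inner ℝ (gradient (G i) (rk.step R t q h)) (∑ j, lam j •
      (‖(rk.stageSpan R t q h).starProjection (gradient (G j) (rk.step R t q h))‖⁻¹ •
        (rk.stageSpan R t q h).starProjection (gradient (G j) (rk.step R t q h))))) =
      rk.qoJac R G t q h lam := by
    ext i
    rw [qoJac_apply, qoDisp_apply]; rfl
  rw [h7] at h6
  linarith [norm_nonneg (rk.qoJac R G t q h lam)]

/-- The directions have norm at most one, so the displacement is at most `l * ‖λ‖` whatever the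
stage span; hence `ρ` can be chosen independently of `h`. -/
theorem eventually_approximatesLinearOn_qoJac
    (hR : Continuous (fun x : ℝ × State m => R x.1 x.2))
    (hG : ∀ j, ContDiff ℝ ∞ (G j)) {c : NNReal} (hc : 0 < c) :
    ∃ ρ > 0, ∀ᶠ h in 𝓝[>] (0 : ℝ),
      ApproximatesLinearOn (fun lam i => G i (rk.qoPoint R G t q h lam)) (rk.qoJac R G t q h)
        (Metric.closedBall 0 ρ) c := by
  have hε : (0 : ℝ) < c / (l + 1) := by positivity
  choose r hr hr' using fun i => exists_ball_approximates_gradient (hG i) q hε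
  obtain ⟨r₀, hr₀, hr₀'⟩ : ∃ r₀ > 0, ∀ i, r₀ ≤ r i := by
    have : ∀ᶠ x in 𝓝[>] (0 : ℝ), ∀ i, x ≤ r i :=
      eventually_all.mpr fun i => Filter.mem_of_superset (Ioc_mem_nhdsGT (hr i)) fun _ h => h.2
    obtain ⟨x, hx, hx0⟩ := (this.and self_mem_nhdsWithin).exists
    exact ⟨x, hx0, hx⟩
  -- Half of `r₀` is for the Runge–Kutta step and half for the displacement; `l + 1` replaces `l` to
  -- allow `l = 0`.
  refine ⟨r₀ / (2 * (l + 1)), by positivity, ?_⟩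
  filter_upwards [(rk.tendsto_step hR t q).eventually (Metric.ball_mem_nhds q (half_pos hr₀))]
    with h hh x hx y hy
  rw [dist_eq_norm] at hh
  have hmem : ∀ z ∈ Metric.closedBall (0 : Fin l → ℝ) (r₀ / (2 * (l + 1))),
      rk.qoPoint R G t q h z ∈ Metric.ball q r₀ := by
    intro z hz
    rw [mem_closedBall_zero_iff] at hz
    rw [Metric.mem_ball, dist_eq_norm, qoPoint_eq, add_sub_right_comm]
    have h1 : ‖rk.qoDisp R G t q h z‖ ≤ r₀ / 2 := by
      calc _ ≤ l * ‖z‖ := rk.norm_qoDisp_le R G t q h z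
        _ ≤ (l + 1) * (r₀ / (2 * (l + 1))) := by gcongr; linarith
        _ = r₀ / 2 := by field_simp
    linarith [norm_add_le (rk.step R t q h - q) (rk.qoDisp R G t q h z)]
  refine (pi_norm_le_iff_of_nonneg (by positivity)).mpr fun i => ?_
  have hsub : ∀ z ∈ Metric.ball q r₀, z ∈ Metric.ball q (r i) :=
    fun z hz => Metric.ball_subset_ball (hr₀' i) hz
  have h2 := hr' i (rk.step R t q h)
    (hsub _ (by rw [Metric.mem_ball, dist_eq_norm]; linarith)) _ (hsub _ (hmem x hx)) _
    (hsub _ (hmem y hy))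
  have h3 : rk.qoPoint R G t q h x - rk.qoPoint R G t q h y = rk.qoDisp R G t q h (x - y) := by
    rw [qoPoint_eq, qoPoint_eq, map_sub]; abel
  rw [h3] at h2
  calc _ ≤ c / (l + 1) * ‖rk.qoDisp R G t q h (x - y)‖ := h2
    _ ≤ c / (l + 1) * ((l + 1) * ‖x - y‖) := by
        gcongr
        exact (rk.norm_qoDisp_le R G t q h _).trans (by gcongr; linarith)
    _ = c * ‖x - y‖ := by field_simp

theorem isBigO_invariant_step (hR : ContDiff ℝ ∞ (fun x : ℝ × State m => R x.1 x.2))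
    {T : ℝ} {G : State m → ℝ} (hG : IsInvariant R T G) {p : ℕ} (hrk : rk.HasOrder p)
    (ht : t ∈ Set.Ico 0 T) {δ : ℝ} (hδ : 0 < δ) {u : ℝ → State m} (hu : IsSolution R t q δ u) :
    (fun h => G q - G (rk.step R t q h)) =O[𝓝[>] 0] (fun h : ℝ => h ^ (p + 1)) := by
  have h1 : HasStrictFDerivAt G (fderiv ℝ G q) q := hG.1.contDiffAt.hasStrictFDerivAt (by simp)
  have h2 := h1.isBigO_sub.comp_tendsto
    ((rk.tendsto_step hR.continuous t q).prodMk_nhds (hu.tendsto hδ))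
  have h3 := (h2.trans (hrk m R hR t q δ u hδ hu)).neg_left
  refine h3.congr' ?_ EventuallyEq.rfl
  -- Invariance holds only up to time `T`, so `h ≤ T - t` is needed; `t < T` makes this true for
  -- small `h`.
  filter_upwards [Ioc_mem_nhdsGT hδ, Ioc_mem_nhdsGT (sub_pos.mpr ht.2)] with h hh hh'
  simp only [Function.comp_apply, neg_sub]
  rw [hG.eq_of_isSolution ht.1 hu hh.1 hh.2 (by linarith [hh'.2])]

end ExplicitRK

end QuasiOrth

/-! ### Solvability and order of the projected scheme -/

theorem mainTheorem5 {m s l p : ℕ} (hp : 2 ≤ p)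
    (R : ℝ → QuasiOrth.State m → QuasiOrth.State m)
    (hR : ContDiff ℝ ∞ (fun x : ℝ × QuasiOrth.State m => R x.1 x.2))
    (T : ℝ) (G : Fin l → QuasiOrth.State m → ℝ)
    (hG : ∀ j, QuasiOrth.IsInvariant R T (G j))
    (rk : QuasiOrth.ExplicitRK s) (hrk : rk.HasOrder p)
    (t : ℝ) (ht : t ∈ Set.Ico 0 T) (q : QuasiOrth.State m)
    (Φ : Fin l → ℝ → QuasiOrth.State m)
    (hΦ : ∀ᶠ h in 𝓝[>] (0 : ℝ), ∀ j, Φ j h ∈ rk.stageSpan R t q h ∧ ‖Φ j h‖ = 1)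
    (M : Matrix (Fin l) (Fin l) ℝ)
    (hM : Tendsto (fun h : ℝ => rk.dirMatrix R G t q h (fun j => Φ j h)) (𝓝[>] 0) (𝓝 M))
    (hdet : M.det ≠ 0) :
    ∃ hstar > (0 : ℝ), ∃ ρ > (0 : ℝ),
      (∀ h ∈ Set.Ioc 0 hstar,
        (∀ j, rk.gradS R (G j) t q h ≠ 0) ∧
        ∃ lam : Fin l → ℝ, ‖lam‖ ≤ ρ ∧ rk.SolvesQO R G t q h lam) ∧
      ∀ lam : ℝ → Fin l → ℝ,
        (∀ h ∈ Set.Ioc 0 hstar, ‖lam h‖ ≤ ρ ∧ rk.SolvesQO R G t q h (lam h)) →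
        QuasiOrth.OrderAt R t q (fun h => rk.qoPoint R G t q h (lam h)) p := by
  have hGs : ∀ j, ContDiff ℝ ∞ (G j) := fun j => (hG j).1
  obtain ⟨K, hK0, hK⟩ := rk.eventually_qoJac_bound hR.continuous hGs Φ hΦ M hM hdet
  -- The tolerance `1 / (2 * K)` is the largest satisfying `K * c ≤ 1 / 2`.
  obtain ⟨ρ, hρ0, hρ⟩ := rk.eventually_approximatesLinearOn_qoJac (t := t) (q := q)
    hR.continuous hGs (c := (1 / (2 * K)).toNNReal)
    (Real.toNNReal_pos.mpr (by positivity))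
  have hc : K * (1 / (2 * K)).toNNReal ≤ 1 / 2 := by
    rw [Real.coe_toNNReal _ (by positivity)]
    exact le_of_eq (by field_simp)
  have hpt0 : ∀ h, rk.qoPoint R G t q h 0 = rk.step R t q h := fun h => by
    rw [rk.qoPoint_eq, map_zero, add_zero]
  have hres : ∀ᶠ h in 𝓝[>] (0 : ℝ),
      ‖(fun i => G i q) - fun i => G i (rk.qoPoint R G t q h 0)‖ ≤ ρ / (2 * K) := by
    have h1 : Tendsto (fun h => (fun i => G i q) - fun i => G i (rk.step R t q h)) (𝓝[>] 0)
        (𝓝 ((fun i => G i q) - fun i => G i q)) :=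
      tendsto_const_nhds.sub (tendsto_pi_nhds.mpr fun i =>
        ((hGs i).continuous.tendsto q).comp (rk.tendsto_step hR.continuous t q))
    have h2 := h1.norm
    rw [sub_self, norm_zero] at h2
    simp only [hpt0]
    exact (h2.eventually_lt_const (by positivity)).mono fun _ h => h.le
  obtain ⟨hstar, hpos, hsub⟩ :=
    mem_nhdsGT_iff_exists_Ioc_subset.mp ((hK.and (hρ.and hres)))
  refine ⟨hstar, hpos, ρ, hρ0, fun h hh => ?_, fun lam hlam δ u hδ hu => ?_⟩
  · obtain ⟨⟨hne, hinv⟩, happ, hr⟩ := hsub hh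
    refine ⟨hne, ?_⟩
    obtain ⟨x, hx, hxy⟩ := happ.exists_eq_of_antilipschitz hK0 hinv hc hρ0.le hr
    exact ⟨x, hx, fun i => congrFun hxy i⟩
  · have h1 : (fun h => rk.step R t q h - u (t + h)) =O[𝓝[>] 0] (fun h : ℝ => h ^ (p + 1)) :=
      hrk m R hR t q δ u hδ hu
    have h2 : (fun h => (fun i => G i q - G i (rk.step R t q h) : Fin l → ℝ)) =O[𝓝[>] 0]
        (fun h : ℝ => h ^ (p + 1)) :=
      isBigO_pi.mpr fun i => rk.isBigO_invariant_step hR (hG i) hrk ht hδ hu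
    have h3 : (fun h => rk.qoDisp R G t q h (lam h)) =O[𝓝[>] 0]
        (fun h => (fun i => G i q - G i (rk.step R t q h) : Fin l → ℝ)) := by
      refine IsBigO.of_bound (l * (2 * K)) ?_
      filter_upwards [Ioc_mem_nhdsGT hpos] with h hh
      obtain ⟨⟨_, hinv⟩, happ, _⟩ := hsub hh
      have h4 := happ.norm_le_of_antilipschitz hK0 hinv hc
        (Metric.mem_closedBall_self hρ0.le) (mem_closedBall_zero_iff.mpr (hlam h hh).1)
      have h5 : ((fun i => G i (rk.qoPoint R G t q h (lam h))) -
          fun i => G i (rk.qoPoint R G t q h 0)) =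
          fun i => G i q - G i (rk.step R t q h) := by
        ext i
        rw [Pi.sub_apply, (hlam h hh).2 i, hpt0]
      rw [h5] at h4
      calc _ ≤ l * ‖lam h‖ := rk.norm_qoDisp_le R G t q h (lam h)
        _ ≤ l * (2 * K * ‖fun i => G i q - G i (rk.step R t q h)‖) := by gcongr
        _ = _ := by ring
    refine (h1.add (h3.trans h2)).congr_left fun h => ?_
    beta_reduce
    rw [rk.qoPoint_eq]; abel
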